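/- **Theorem (Probabilistic bounds on the stability of $\widetilde A_{\mathrm{cl}}$).** Let $A\in\mathbb R^{n\times n}$ and $B\in\mathbb R^{n\times m}$ with $n\ge 1$, and let $F:\mathbb R^{mT\times N}\times\mathbb R^{p\times N}\to\mathbb R^{m\times n}$ be a map (a data-driven control algorithm). Let $(U,X)$ be given data, $K=F(U,X)$ and $A_{\mathrm{cl}}=A+BK$. Assume that $\rho(A_{\mathrm{cl}})<1$, where $\rho$ is the spectral radius, that $A_{\mathrm{cl}}$ is diagonalizable over $\mathbb C$, and that $F(U,\cdot)$ is Fréchet differentiable at $X$. Let $J_X(U,X)$ be the Jacobian matrix of $\mathrm{vec}(F(U,X))$ with respect to $\mathrm{vec}(X)$, and let $J_i\in\mathbb R^{m\times n}$ be the matrix whose vectorization is the $i$-th column of $J_X(U,X)$. Let $Z$ be a random $p\times N$ matrix, let $z_i$ be the $i$-th component of $\mathrm{vec}(Z)$, and let $\mathrm{supp}(Z)$ be the set of those $i$ for which $z_i$ is not almost surely zero. Assume that the $z_i$, $i\in\mathrm{supp}(Z)$, are independent with $z_i\sim\mathcal N(0,\sigma_i^2)$. Set $$\widetilde A_{\mathrm{cl}}=A_{\mathrm{cl}}+\sum_{i\in\mathrm{supp}(Z)}z_i\,BJ_i,\qquad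 \mu=\mathrm{tr}(A_{\mathrm{cl}}),\qquad \underline v=\sum_{i\in\mathrm{supp}(Z)}\sigma_i^2\,[\mathrm{tr}(BJ_i)]^2,$$ $$\overline v=\max\Big\{\Big\|\sum_{i\in\mathrm{supp}(Z)}\sigma_i^2\,BJ_i(BJ_i)^{\mathsf T}\Big\|,\ \Big\|\sum_{i\in\mathrm{supp}(Z)}\sigma_i^2\,(BJ_i)^{\mathsf T}BJ_i\Big\|\Big\},$$ where $\|\cdot\|$ is the matrix norm induced by the Euclidean vector norm. Let $\mathbb Q$ be the complementary cumulative distribution function of the standard normal distribution. For every invertible $V\in\mathbb C^{n\times n}$ whose columns are eigenvectors of $A_{\mathrm{cl}}$, let $\kappa=\|V\|\,\|V^{-1}\|$ be its condition number. Then, for every such $V$, $$\mathbb Q\Big(\frac{n+\mu}{\sqrt{\underline v}}\Big)+\mathbb Q\Big(\frac{n-\mu}{\sqrt{\underline v}}\Big)\ \le\ \mathbb P\big[\rho(\widetilde A_{\mathrm{cl}})\ge 1\big]\ \le\ 2n\exp\Big(\frac{-(1-\rho(A_{\mathrm{cl}}))^2}{2\,\overline v\,\kappa^2}\Big).$$ If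 $\underline v=0$, the left-hand side is read as its limit $0$; if $\overline v=0$, the right-hand side is read as its limit $0$, so that the probability is zero. -/

import Mathlib

namespace DataDriven

open MeasureTheory ProbabilityTheory
open scoped NNReal Matrix

noncomputable section

/-- Spectral radius of a real square matrix: the largest modulus of a complex eigenvalue. -/
def rho {n : ℕ} (M : Matrix (Fin n) (Fin n) ℝ) : ℝ :=
  (spectralRadius ℂ (M.map (algebraMap ℝ ℂ))).toReal

open scoped Matrix.Norms.L2Operator in
/-- The matrix norm induced by the Euclidean vector norm. -/
def opNorm {𝕜 : Type*} [RCLike 𝕜] {n : ℕ} (M : Matrix (Fin n) (Fin n) 𝕜) : ℝ := ‖M‖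

/-- `V` is an invertible complex matrix whose columns are eigenvectors of the real matrix `A`. -/
def IsEigenvectorMatrix {n : ℕ} (A : Matrix (Fin n) (Fin n) ℝ)
    (V : Matrix (Fin n) (Fin n) ℂ) : Prop :=
  IsUnit V ∧ ∃ d : Fin n → ℂ, A.map (algebraMap ℝ ℂ) * V = V * Matrix.diagonal d

/-- Diagonalizability (over the complex numbers) of a real square matrix. -/
def IsDiagonalizable {n : ℕ} (A : Matrix (Fin n) (Fin n) ℝ) : Prop :=
  ∃ V : Matrix (Fin n) (Fin n) ℂ, IsEigenvectorMatrix A V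

/-- Condition number of an invertible matrix with respect to the spectral norm. -/
def condNumber {n : ℕ} (V : Matrix (Fin n) (Fin n) ℂ) : ℝ := opNorm V * opNorm V⁻¹

/-- Complementary cumulative distribution function of the standard normal distribution. -/
def Q (x : ℝ) : ℝ := (gaussianReal 0 1).real (Set.Ioi x)

/-- Inverse of the column-stacking vectorization `Matrix.vec`. -/
def unvec {r c : ℕ} (x : Fin c × Fin r → ℝ) : Matrix (Fin r) (Fin c) ℝ :=
  Matrix.of fun i j => x (j, i)

theorem unvec_vec {r c : ℕ} (M : Matrix (Fin r) (Fin c) ℝ) : unvec M.vec = M := rfl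

theorem vec_unvec {r c : ℕ} (x : Fin c × Fin r → ℝ) : (unvec x).vec = x := rfl

section Setup

variable {n m T N p : ℕ}

/-- The map `X ↦ F (U, X)` in vectorized coordinates. -/
def vecMap (F : Matrix (Fin (m * T)) (Fin N) ℝ → Matrix (Fin p) (Fin N) ℝ →
      Matrix (Fin m) (Fin n) ℝ)
    (U : Matrix (Fin (m * T)) (Fin N) ℝ) (x : Fin N × Fin p → ℝ) : Fin n × Fin m → ℝ :=
  (F U (unvec x)).vec

/-- The Jacobian matrix `J_X (U, X)` of `vec (F (U, X))` with respect to `vec X`. -/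
def jacobian (F : Matrix (Fin (m * T)) (Fin N) ℝ → Matrix (Fin p) (Fin N) ℝ →
      Matrix (Fin m) (Fin n) ℝ)
    (U : Matrix (Fin (m * T)) (Fin N) ℝ) (X : Matrix (Fin p) (Fin N) ℝ) :
    Matrix (Fin n × Fin m) (Fin N × Fin p) ℝ :=
  LinearMap.toMatrix' (fderiv ℝ (vecMap F U) X.vec).toLinearMap

/-- The matrix `J i`, whose vectorization is the `i`-th column of the Jacobian matrix. -/
def J (F : Matrix (Fin (m * T)) (Fin N) ℝ → Matrix (Fin p) (Fin N) ℝ →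
      Matrix (Fin m) (Fin n) ℝ)
    (U : Matrix (Fin (m * T)) (Fin N) ℝ) (X : Matrix (Fin p) (Fin N) ℝ)
    (i : Fin N × Fin p) : Matrix (Fin m) (Fin n) ℝ :=
  unvec ((jacobian F U X).col i)

open Classical in
/-- The set of compromised entries: those `i` for which the random variable `z i`, the `i`-th
component of `vec Z`, is not (almost surely) zero. -/
def supp {Ω : Type*} [MeasurableSpace Ω] (P : Measure Ω) (Z : Ω → Matrix (Fin p) (Fin N) ℝ) :
    Finset (Fin N × Fin p) :=
  Finset.univ.filter fun i => ¬ (fun ω => (Z ω).vec i) =ᵐ[P] fun _ => 0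

end Setup

section Parameters

variable {n : ℕ} {ι : Type*}

/-- The linearly perturbed matrix `A + ∑ i ∈ S, z i • D i`. -/
def perturbed (A : Matrix (Fin n) (Fin n) ℝ) (S : Finset ι) (z : ι → ℝ)
    (D : ι → Matrix (Fin n) (Fin n) ℝ) : Matrix (Fin n) (Fin n) ℝ :=
  A + ∑ i ∈ S, z i • D i

/-- The matrix variance parameter of the series `∑ i ∈ S, z i • D i`. -/
def vUpper (S : Finset ι) (σ : ι → ℝ≥0) (D : ι → Matrix (Fin n) (Fin n) ℝ) : ℝ :=
  max (opNorm (∑ i ∈ S, ((σ i : ℝ) ^ 2) • (D i * (D i)ᵀ)))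
    (opNorm (∑ i ∈ S, ((σ i : ℝ) ^ 2) • ((D i)ᵀ * D i)))

/-- The variance of the trace of the series `∑ i ∈ S, z i • D i`. -/
def vLower (S : Finset ι) (σ : ι → ℝ≥0) (D : ι → Matrix (Fin n) (Fin n) ℝ) : ℝ :=
  ∑ i ∈ S, (σ i : ℝ) ^ 2 * (D i).trace ^ 2

end Parameters

end

end DataDriven

/-! Write E for the random part of the perturbed matrix. For the lower bound, the trace is at most n
times the spectral radius (`abs_trace_le_mul_rho`), so a trace of modulus at least n forces
instability. That trace is Gaussian with mean μ and variance `vLower`, and its tails beyond n and -n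
are disjoint events (`Q_add_Q_le`).

For the upper bound, the Bauer-Fike argument (`norm_sub_rho_le_condNumber_mul`) shows that
instability forces ‖E‖ ≥ (1 - ρ)/κ. The rest is the tail bound P(‖E‖ ≥ t) ≤ 2n exp(-t²/(2v))
(`measureReal_opNorm_ge_le`), obtained from moments rather than matrix exponentials. The Hermitian
dilation replaces E by a symmetric series X. Gaussian integration by parts, together with tr(A X^j A
X^l) ≤ tr(A² X^(j+l)) for even j+l, gives E tr X^(2q+2) ≤ (2q+1) v E tr X^(2q), hence scalar
Gaussian moments times the dimension (`integral_trace_pow_le`). Markov's inequality for all even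
powers, weighted and summed to a cosh series, yields the constant 2n. -/

namespace DataDriven

open MeasureTheory ProbabilityTheory
open scoped NNReal Matrix

/-! ### Trace inequalities for real symmetric matrices. -/

section TraceInequalities

variable {d : Type*} [Fintype d] [DecidableEq d]

/-- The spectral theorem for real symmetric matrices, in matrix form and for all powers. -/
theorem exists_diagonalization_pow {X : Matrix d d ℝ} (hX : X.IsHermitian) :
    ∃ U : Matrix d d ℝ, U * Uᵀ = 1 ∧ Uᵀ * U = 1 ∧
      ∀ k : ℕ, X ^ k = U * Matrix.diagonal (fun a => hX.eigenvalues a ^ k) * Uᵀ := by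
  have h1 : (hX.eigenvectorUnitary : Matrix d d ℝ) * (hX.eigenvectorUnitary : Matrix d d ℝ)ᵀ = 1 := by
    have := Unitary.coe_mul_star_self hX.eigenvectorUnitary
    rwa [Unitary.coe_star, Matrix.star_eq_conjTranspose, Matrix.conjTranspose_eq_transpose_of_trivial] at this
  have h2 : (hX.eigenvectorUnitary : Matrix d d ℝ)ᵀ * (hX.eigenvectorUnitary : Matrix d d ℝ) = 1 := by
    have := Unitary.coe_star_mul_self hX.eigenvectorUnitary
    rwa [Matrix.star_eq_conjTranspose, Matrix.conjTranspose_eq_transpose_of_trivial] at this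
  have h3 := hX.spectral_theorem
  rw [Unitary.conjStarAlgAut_apply, Matrix.star_eq_conjTranspose,
    Matrix.conjTranspose_eq_transpose_of_trivial] at h3
  refine ⟨hX.eigenvectorUnitary, h1, h2, fun k => ?_⟩
  generalize (hX.eigenvectorUnitary : Matrix d d ℝ) = U at h1 h2 h3
  generalize hX.eigenvalues = ev at h3
  induction k with
  | zero => simp [h1]
  | succ k ih =>
    rw [pow_succ, ih, h3]
    calc _ = U * Matrix.diagonal (fun a => ev a ^ k) * (Uᵀ * U) *
          Matrix.diagonal (RCLike.ofReal ∘ ev) * Uᵀ := by simp only [Matrix.mul_assoc]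
      _ = _ := by
        rw [h2, Matrix.mul_one, Matrix.mul_assoc U, Matrix.diagonal_mul_diagonal]
        simp [pow_succ]

/-- Rearrangement: for nonnegative reals, both powers are ordered the same way. Evenness of j + l
lets absolute values replace a and b on the right. -/
theorem pow_mul_pow_add_pow_mul_pow_le (a b : ℝ) {j l : ℕ} (h : Even (j + l)) :
    a ^ j * b ^ l + a ^ l * b ^ j ≤ a ^ (j + l) + b ^ (j + l) := by
  have key : ∀ x y : ℝ, 0 ≤ x → 0 ≤ y → 0 ≤ (x ^ j - y ^ j) * (x ^ l - y ^ l) := by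
    intro x y hx hy
    rcases le_total x y with hxy | hxy
    · exact mul_nonneg_of_nonpos_of_nonpos (sub_nonpos.2 (pow_le_pow_left₀ hx hxy _))
        (sub_nonpos.2 (pow_le_pow_left₀ hx hxy _))
    · exact mul_nonneg (sub_nonneg.2 (pow_le_pow_left₀ hy hxy _))
        (sub_nonneg.2 (pow_le_pow_left₀ hy hxy _))
  have h1 := key |a| |b| (abs_nonneg _) (abs_nonneg _)
  have h2 : a ^ j * b ^ l ≤ |a| ^ j * |b| ^ l := by
    rw [← abs_pow, ← abs_pow, ← abs_mul]; exact le_abs_self _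
  have h3 : a ^ l * b ^ j ≤ |a| ^ l * |b| ^ j := by
    rw [← abs_pow, ← abs_pow, ← abs_mul]; exact le_abs_self _
  rw [← h.pow_abs a, ← h.pow_abs b, pow_add, pow_add]
  nlinarith

/-- Separating the two occurrences of `A` by powers of `X` does not increase the trace. -/
theorem trace_mul_pow_mul_mul_pow_le {A X : Matrix d d ℝ} (hA : A.IsHermitian)
    (hX : X.IsHermitian) {j l : ℕ} (h : Even (j + l)) :
    (A * X ^ j * A * X ^ l).trace ≤ (A * A * X ^ (j + l)).trace := by
  obtain ⟨U, h1, h2, hU⟩ := exists_diagonalization_pow hX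
  set ev := hX.eigenvalues
  -- In an eigenbasis of X both traces are double sums with weights C a b ^ 2. These are symmetric
  -- in a and b, so averaging over the swap leaves the scalar rearrangement inequality.
  set C := Uᵀ * A * U with hC
  have hsymm : ∀ a b, C b a = C a b := by
    have : Cᵀ = C := by
      have hA' : Aᵀ = A := by rwa [Matrix.IsHermitian, Matrix.conjTranspose_eq_transpose_of_trivial] at hA
      simp [hC, Matrix.transpose_mul, hA', Matrix.mul_assoc]
    intro a b
    exact congrFun (congrFun this a) b
  have e1 : (A * X ^ j * A * X ^ l).trace = ∑ a, ∑ b, C a b ^ 2 * (ev b ^ j * ev a ^ l) := by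
    have : (A * X ^ j * A * X ^ l).trace =
        ((C * Matrix.diagonal fun a => ev a ^ j) * (C * Matrix.diagonal fun a => ev a ^ l)).trace := by
      rw [hU, hU, ← Matrix.mul_assoc (A * _ * A), Matrix.trace_mul_comm]
      simp only [hC, Matrix.mul_assoc]
    rw [this, Matrix.trace]
    refine Finset.sum_congr rfl fun a _ => ?_
    rw [Matrix.diag_apply, Matrix.mul_apply]
    refine Finset.sum_congr rfl fun b _ => ?_
    rw [Matrix.mul_diagonal, Matrix.mul_diagonal, hsymm a b]
    ring
  have e2 : (A * A * X ^ (j + l)).trace = ∑ a, ∑ b, C a b ^ 2 * ev a ^ (j + l) := by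
    have : (A * A * X ^ (j + l)).trace =
        (C * (C * Matrix.diagonal fun a => ev a ^ (j + l))).trace := by
      rw [hU, ← Matrix.mul_assoc (A * A), Matrix.trace_mul_comm]
      have : A * A = A * (U * Uᵀ) * A := by rw [h1, Matrix.mul_one]
      rw [this]
      simp only [hC, Matrix.mul_assoc]
    rw [this, Matrix.trace]
    refine Finset.sum_congr rfl fun a _ => ?_
    rw [Matrix.diag_apply, Matrix.mul_apply]
    refine Finset.sum_congr rfl fun b _ => ?_
    rw [Matrix.mul_diagonal, hsymm a b]
    ring
  have swap : ∀ f : d → d → ℝ, ∑ a, ∑ b, C a b ^ 2 * f a b = ∑ a, ∑ b, C a b ^ 2 * f b a := by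
    intro f
    rw [Finset.sum_comm]
    simp only [hsymm]
  have e3 : 2 * (A * X ^ j * A * X ^ l).trace =
      ∑ a, ∑ b, C a b ^ 2 * (ev a ^ j * ev b ^ l + ev a ^ l * ev b ^ j) := by
    have e1' := e1.trans (swap _)
    rw [two_mul]
    nth_rewrite 1 [e1]
    rw [e1']
    simp only [← Finset.sum_add_distrib]
    refine Finset.sum_congr rfl fun a _ => Finset.sum_congr rfl fun b _ => ?_
    ring
  have e4 : 2 * (A * A * X ^ (j + l)).trace =
      ∑ a, ∑ b, C a b ^ 2 * (ev a ^ (j + l) + ev b ^ (j + l)) := by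
    have e2' := e2.trans (swap fun a _ => ev a ^ (j + l))
    rw [two_mul]
    nth_rewrite 1 [e2]
    rw [e2']
    simp only [← Finset.sum_add_distrib, mul_add]
  have : 2 * (A * X ^ j * A * X ^ l).trace ≤ 2 * (A * A * X ^ (j + l)).trace := by
    rw [e3, e4]
    refine Finset.sum_le_sum fun a _ => Finset.sum_le_sum fun b _ => ?_
    exact mul_le_mul_of_nonneg_left (pow_mul_pow_add_pow_mul_pow_le _ _ h) (sq_nonneg _)
  linarith

/-- The even power splits as X^q · X^q, so cyclicity reduces the claim to the trace of v - V
conjugated by X^q. -/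
theorem trace_mul_pow_le_of_posSemidef_sub {V X : Matrix d d ℝ} {v : ℝ}
    (hV : (v • (1 : Matrix d d ℝ) - V).PosSemidef) (hX : X.IsHermitian) (q : ℕ) :
    (V * X ^ (2 * q)).trace ≤ v * (X ^ (2 * q)).trace := by
  have h1 := (hV.conjTranspose_mul_mul_same (X ^ q)).trace_nonneg
  have h2 : (X ^ q)ᴴ = X ^ q := hX.pow q
  rw [h2, Matrix.trace_mul_comm, ← Matrix.mul_assoc, ← pow_add, ← two_mul, Matrix.trace_mul_comm,
    Matrix.sub_mul, Matrix.trace_sub, Matrix.smul_mul, Matrix.one_mul, Matrix.trace_smul,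
    smul_eq_mul] at h1
  linarith

end TraceInequalities

/-! ### Operator norm against traces and the semidefinite order. -/

section Norms

open scoped Matrix.Norms.L2Operator

theorem opNorm_nonneg {𝕜 : Type*} [RCLike 𝕜] {n : ℕ} (M : Matrix (Fin n) (Fin n) 𝕜) :
    0 ≤ opNorm M := norm_nonneg M

/-- A power of `MᵀM` has trace at least the corresponding power of the squared norm of `M`. -/
theorem opNorm_pow_le_trace {n : ℕ} (hn : 0 < n) (M : Matrix (Fin n) (Fin n) ℝ) (p : ℕ) :
    opNorm M ^ (2 * p) ≤ ((Mᵀ * M) ^ p).trace := by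
  have : Nonempty (Fin n) := ⟨⟨0, hn⟩⟩
  have hG : (Mᵀ * M).PosSemidef := by
    simpa [Matrix.conjTranspose_eq_transpose_of_trivial] using Matrix.posSemidef_conjTranspose_mul_self M
  obtain ⟨U, h1, h2, hU⟩ := exists_diagonalization_pow hG.1
  set ev := hG.1.eigenvalues with hev
  have hnn : ∀ a, 0 ≤ ev a := hG.eigenvalues_nonneg
  -- The largest eigenvalue of MᵀM dominates ‖M‖²; the other eigenvalues only add nonnegative terms
  -- to the trace.
  obtain ⟨a, ha⟩ := Finite.exists_max ev
  have htr : ((Mᵀ * M) ^ p).trace = ∑ b, ev b ^ p := by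
    rw [hU, Matrix.trace_mul_comm, ← Matrix.mul_assoc, h2, Matrix.one_mul, Matrix.trace_diagonal]
  have hUn : ‖U‖ ≤ 1 ∧ ‖Uᵀ‖ ≤ 1 := by
    have e1 := Matrix.l2_opNorm_conjTranspose_mul_self U
    have e2 := Matrix.l2_opNorm_conjTranspose U
    rw [Matrix.conjTranspose_eq_transpose_of_trivial] at e1 e2
    rw [h2, CStarRing.norm_one] at e1
    constructor <;> nlinarith [norm_nonneg U]
  have hD : ‖Matrix.diagonal ev‖ ≤ ev a := by
    rw [Matrix.l2_opNorm_diagonal]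
    exact (pi_norm_le_iff_of_nonneg (hnn a)).2 fun b => by
      rw [Real.norm_of_nonneg (hnn b)]; exact ha b
  have hle : opNorm M ^ 2 ≤ ev a := by
    have e1 := Matrix.l2_opNorm_conjTranspose_mul_self M
    rw [Matrix.conjTranspose_eq_transpose_of_trivial] at e1
    have e2 := hU 1
    simp only [pow_one] at e2
    rw [opNorm, pow_two, ← e1, e2]
    calc _ ≤ ‖U‖ * ‖Matrix.diagonal ev‖ * ‖Uᵀ‖ := Matrix.l2_opNorm_mul _ _ |>.trans
            (mul_le_mul_of_nonneg_right (Matrix.l2_opNorm_mul _ _) (norm_nonneg _))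
      _ ≤ 1 * ev a * 1 := by
        have := hnn a
        gcongr
        exacts [hUn.1, hUn.2]
      _ = ev a := by ring
  rw [htr, pow_mul]
  calc _ ≤ ev a ^ p := pow_le_pow_left₀ (sq_nonneg _) hle p
    _ ≤ _ := Finset.single_le_sum (f := fun b => ev b ^ p) (fun b _ => pow_nonneg (hnn b) p)
      (Finset.mem_univ a)

theorem opNorm_transpose {n : ℕ} (M : Matrix (Fin n) (Fin n) ℝ) : opNorm Mᵀ = opNorm M := by
  have := Matrix.l2_opNorm_conjTranspose M
  rwa [Matrix.conjTranspose_eq_transpose_of_trivial] at this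

/-- Cauchy-Schwarz gives ⟨x, Mx⟩ ≤ ‖M‖ ‖x‖². -/
theorem posSemidef_smul_one_sub {n : ℕ} {M : Matrix (Fin n) (Fin n) ℝ} (hM : M.IsHermitian)
    {v : ℝ} (h : opNorm M ≤ v) : (v • (1 : Matrix (Fin n) (Fin n) ℝ) - M).PosSemidef := by
  refine Matrix.PosSemidef.of_dotProduct_mulVec_nonneg ?_ fun x => ?_
  · exact (Matrix.isHermitian_one.smul (IsSelfAdjoint.all v)).sub hM
  · have h1 := Matrix.l2_opNorm_mulVec M (WithLp.toLp 2 x)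
    have h2 := real_inner_le_norm (WithLp.toLp 2 x) (WithLp.toLp 2 (M *ᵥ x))
    have h3 : inner ℝ (WithLp.toLp 2 x) (WithLp.toLp 2 x) = star x ⬝ᵥ x := by
      rw [EuclideanSpace.inner_toLp_toLp, dotProduct_comm]
    have h4 : inner ℝ (WithLp.toLp 2 x) (WithLp.toLp 2 (M *ᵥ x)) = star x ⬝ᵥ (M *ᵥ x) := by
      rw [EuclideanSpace.inner_toLp_toLp, dotProduct_comm]
    rw [real_inner_self_eq_norm_sq] at h3
    rw [Matrix.sub_mulVec, dotProduct_sub, Matrix.smul_mulVec, Matrix.one_mulVec, dotProduct_smul,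
      ← h3, ← h4, smul_eq_mul]
    have h5 : ‖WithLp.toLp 2 (M *ᵥ x)‖ ≤ v * ‖WithLp.toLp 2 x‖ :=
      h1.trans (mul_le_mul_of_nonneg_right h (norm_nonneg _))
    nlinarith [norm_nonneg (WithLp.toLp 2 x)]

end Norms

/-! ### Gaussian integration by parts. -/

section Stein

theorem hasDerivAt_gaussianPDFReal {v : ℝ≥0} (hv : v ≠ 0) (x : ℝ) :
    HasDerivAt (gaussianPDFReal 0 v) (-(x / v) * gaussianPDFReal 0 v x) x := by
  have hv' : (v : ℝ) ≠ 0 := by exact_mod_cast hv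
  have h := ((((hasDerivAt_id x).sub_const 0).pow 2).neg.div_const (2 * (v : ℝ))).exp.const_mul
    ((√(2 * Real.pi * v))⁻¹)
  rw [gaussianPDFReal_def]
  convert! h using 1
  simp
  field_simp

theorem integrable_gaussianReal_iff {v : ℝ≥0} (hv : v ≠ 0) {f : ℝ → ℝ} :
    Integrable f (gaussianReal 0 v) ↔ Integrable fun x => gaussianPDFReal 0 v x * f x := by
  rw [gaussianReal_of_var_ne_zero _ hv, integrable_withDensity_iff_integrable_smul'
    (measurable_gaussianPDF _ _) (Filter.Eventually.of_forall fun x => gaussianPDF_lt_top)]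
  simp [toReal_gaussianPDF]

/-- Gaussian integration by parts (Stein's lemma). -/
theorem integral_id_mul_gaussianReal {v : ℝ≥0} {f f' : ℝ → ℝ} (hf : ∀ x, HasDerivAt f (f' x) x)
    (h0 : Integrable f (gaussianReal 0 v)) (h1 : Integrable f' (gaussianReal 0 v))
    (h2 : Integrable (fun x => x * f x) (gaussianReal 0 v)) :
    ∫ x, x * f x ∂(gaussianReal 0 v) = v * ∫ x, f' x ∂(gaussianReal 0 v) := by
  by_cases hv : v = 0
  · simp [hv]
  have hv' : (v : ℝ) ≠ 0 := by exact_mod_cast hv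
  rw [integrable_gaussianReal_iff hv] at h0 h1 h2
  rw [integral_gaussianReal_eq_integral_smul hv, integral_gaussianReal_eq_integral_smul hv]
  -- The density φ satisfies φ' = -(x/v) φ; integrability of the products removes the boundary
  -- terms.
  have key := integral_mul_deriv_eq_deriv_mul_of_integrable (u := f) (u' := f')
    (v := gaussianPDFReal 0 v) (v' := fun x => -(x / v) * gaussianPDFReal 0 v x)
    (fun x _ => hf x) (fun x _ => hasDerivAt_gaussianPDFReal hv x)
    ((h2.const_mul (-(v : ℝ)⁻¹)).congr (Filter.Eventually.of_forall fun x => by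
      simp only [Pi.mul_apply]; ring))
    (h1.congr (Filter.Eventually.of_forall fun x => mul_comm _ _))
    (h0.congr (Filter.Eventually.of_forall fun x => mul_comm _ _))
  have e1 : ∫ x, f x * (-(x / v) * gaussianPDFReal 0 v x) =
      -(v : ℝ)⁻¹ * ∫ x, gaussianPDFReal 0 v x • (x * f x) := by
    rw [← integral_const_mul]
    exact integral_congr_ae (Filter.Eventually.of_forall fun x => by
      simp only [smul_eq_mul]; ring)
  have e2 : ∫ x, f' x * gaussianPDFReal 0 v x = ∫ x, gaussianPDFReal 0 v x • f' x :=
    integral_congr_ae (Filter.Eventually.of_forall fun x => mul_comm _ _)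
  rw [e1, e2] at key
  field_simp at key
  linarith

variable {Ω β : Type*} [MeasurableSpace Ω] [MeasurableSpace β] {P : Measure Ω}
  [IsProbabilityMeasure P]

/-- Gaussian integration by parts in one of two independent variables. -/
theorem integral_mul_of_indepFun_gaussianReal {v : ℝ≥0} {Z : Ω → ℝ} {Y : Ω → β}
    (hZ : HasLaw Z (gaussianReal 0 v) P) (hY : AEMeasurable Y P) (hZY : IndepFun Z Y P)
    {f f' : ℝ × β → ℝ} (hf : ∀ x y, HasDerivAt (fun x => f (x, y)) (f' (x, y)) x)
    (hfm : Measurable f) (hfm' : Measurable f')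
    (h0 : Integrable (fun ω => f (Z ω, Y ω)) P) (h1 : Integrable (fun ω => f' (Z ω, Y ω)) P)
    (h2 : Integrable (fun ω => Z ω * f (Z ω, Y ω)) P) :
    ∫ ω, Z ω * f (Z ω, Y ω) ∂P = v * ∫ ω, f' (Z ω, Y ω) ∂P := by
  have hZm := hZ.aemeasurable
  have hZYm : AEMeasurable (fun ω => (Z ω, Y ω)) P := hZm.prodMk hY
  have hlaw : P.map (fun ω => (Z ω, Y ω)) = (gaussianReal 0 v).prod (P.map Y) := by
    rw [(indepFun_iff_map_prod_eq_prod_map_map hZm hY).1 hZY, hZ.map_eq]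
  have : IsProbabilityMeasure (P.map Y) := Measure.isProbabilityMeasure_map hY
  have hgm : Measurable fun q : ℝ × β => q.1 * f q := measurable_fst.mul hfm
  -- Independence makes the joint law a product, so Fubini reduces to the one-variable identity at
  -- almost every fixed y.
  have tr : ∀ g : ℝ × β → ℝ, Measurable g → Integrable (fun ω => g (Z ω, Y ω)) P →
      Integrable g ((gaussianReal 0 v).prod (P.map Y)) ∧
      ∫ ω, g (Z ω, Y ω) ∂P = ∫ y, ∫ x, g (x, y) ∂(gaussianReal 0 v) ∂(P.map Y) := by
    intro g hg hgi
    have hi : Integrable g ((gaussianReal 0 v).prod (P.map Y)) := by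
      rw [← hlaw]
      exact (integrable_map_measure hg.aestronglyMeasurable hZYm).2 hgi
    refine ⟨hi, ?_⟩
    rw [← integral_map hZYm hg.aestronglyMeasurable (f := g), hlaw, integral_prod_symm g hi]
  obtain ⟨i0, -⟩ := tr f hfm h0
  obtain ⟨i1, e1⟩ := tr f' hfm' h1
  obtain ⟨i2, e2⟩ := tr (fun q => q.1 * f q) hgm h2
  rw [e1, e2, ← integral_const_mul]
  refine integral_congr_ae ?_
  filter_upwards [i0.prod_left_ae, i1.prod_left_ae, i2.prod_left_ae] with y y0 y1 y2
  exact integral_id_mul_gaussianReal (fun x => hf x y) y0 y1 y2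

end Stein

/-! ### Integrability of polynomials in Gaussian variables. -/

section Moments

variable {Ω : Type*} [MeasurableSpace Ω] {P : Measure Ω}

/-- The random variable `f` has finite moments of all orders. -/
def HasAllMoments (f : Ω → ℝ) (P : Measure Ω) : Prop := ∀ p : ℝ≥0, MemLp f p P

theorem HasAllMoments.integrable {f : Ω → ℝ} (hf : HasAllMoments f P) : Integrable f P :=
  memLp_one_iff_integrable.1 (hf 1)

/-- Hölder with exponents 2p and 2p. Asking for all moments at once makes the class stable under
products, hence under matrix powers. -/
theorem HasAllMoments.mul {f g : Ω → ℝ} (hf : HasAllMoments f P) (hg : HasAllMoments g P) :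
    HasAllMoments (fun ω => f ω * g ω) P := by
  intro p
  have : ENNReal.HolderTriple ((2 * p : ℝ≥0) : ENNReal) ((2 * p : ℝ≥0) : ENNReal) p := by
    constructor
    rw [ENNReal.coe_mul, ENNReal.mul_inv (by simp) (by simp), ← add_mul]
    simp [ENNReal.inv_two_add_inv_two]
  exact MemLp.mul (hg (2 * p)) (hf (2 * p))

theorem HasAllMoments.sum {ι : Type*} {s : Finset ι} {f : ι → Ω → ℝ}
    (hf : ∀ i ∈ s, HasAllMoments (f i) P) : HasAllMoments (fun ω => ∑ i ∈ s, f i ω) P :=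
  fun p => memLp_finsetSum s fun i hi => hf i hi p

theorem hasAllMoments_const [IsFiniteMeasure P] (c : ℝ) : HasAllMoments (fun _ : Ω => c) P :=
  fun _ => memLp_const c

theorem hasAllMoments_of_hasLaw_gaussianReal {Z : Ω → ℝ} {v : ℝ≥0}
    (hZ : HasLaw Z (gaussianReal 0 v) P) : HasAllMoments Z P := by
  intro p
  have h := memLp_id_gaussianReal (μ := 0) (v := v) p
  rw [← hZ.map_eq] at h
  exact (memLp_map_measure_iff (by fun_prop) hZ.aemeasurable).1 h

variable {d : Type*}

/-- The entries of the random matrix `M` have finite moments of all orders. -/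
def MatrixHasAllMoments (M : Ω → Matrix d d ℝ) (P : Measure Ω) : Prop :=
  ∀ a b, HasAllMoments (fun ω => M ω a b) P

theorem MatrixHasAllMoments.mul [Fintype d] {M N : Ω → Matrix d d ℝ} (hM : MatrixHasAllMoments M P)
    (hN : MatrixHasAllMoments N P) : MatrixHasAllMoments (fun ω => M ω * N ω) P := by
  intro a b
  simp only [Matrix.mul_apply]
  exact HasAllMoments.sum fun c _ => (hM a c).mul (hN c b)

theorem matrixHasAllMoments_const [IsFiniteMeasure P] (M : Matrix d d ℝ) :
    MatrixHasAllMoments (fun _ => M) P := fun a b => hasAllMoments_const (M a b)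

theorem MatrixHasAllMoments.pow [Fintype d] [DecidableEq d] [IsFiniteMeasure P] {M : Ω → Matrix d d ℝ}
    (hM : MatrixHasAllMoments M P) (k : ℕ) : MatrixHasAllMoments (fun ω => M ω ^ k) P := by
  induction k with
  | zero => simpa using matrixHasAllMoments_const (1 : Matrix d d ℝ)
  | succ k ih => simpa only [pow_succ] using ih.mul hM

theorem MatrixHasAllMoments.trace [Fintype d] {M : Ω → Matrix d d ℝ} (hM : MatrixHasAllMoments M P) :
    HasAllMoments (fun ω => (M ω).trace) P := HasAllMoments.sum fun a _ => hM a a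

theorem MatrixHasAllMoments.sum_smul [IsFiniteMeasure P] {ι : Type*} [Fintype ι] {z : ι → Ω → ℝ}
    (hz : ∀ i, HasAllMoments (z i) P) (A : ι → Matrix d d ℝ) :
    MatrixHasAllMoments (fun ω => ∑ i, z i ω • A i) P := by
  intro a b
  simp only [Matrix.sum_apply, Matrix.smul_apply, smul_eq_mul]
  exact HasAllMoments.sum fun i _ => (hz i).mul (hasAllMoments_const _)

end Moments

/-! ### Moment recursion for symmetric Gaussian matrix series. -/

section GaussianSeries

variable {d : Type*} [Fintype d] [DecidableEq d]

-- The noncommutative product rule: each summand differentiates one factor of the power and leaves A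
-- in its place.
open scoped Matrix.Norms.L2Operator in
theorem hasDerivAt_trace_mul_add_smul_pow (A B : Matrix d d ℝ) (m : ℕ) (x : ℝ) :
    HasDerivAt (fun x : ℝ => (A * (x • A + B) ^ m).trace)
      (∑ j ∈ Finset.range m,
        (A * ((x • A + B) ^ (m.pred - j) * A * (x • A + B) ^ j)).trace) x := by
  have h1 : HasDerivAt (fun x : ℝ => x • A + B) A x := by
    simpa using ((hasDerivAt_id x).smul_const A).add_const B
  have h2 := (h1.fun_pow' m).const_mul A
  have h3 := (LinearMap.toContinuousLinearMap
    (Matrix.traceLinearMap d ℝ ℝ)).hasFDerivAt.comp_hasDerivAt x h2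
  simpa [Function.comp_def, Finset.mul_sum, Matrix.trace_sum] using h3

theorem integral_mul_trace_mul_add_pow {Ω κ : Type*} [MeasurableSpace Ω] {P : Measure Ω}
    [IsProbabilityMeasure P] [Fintype κ] {g : Ω → ℝ} {Y : Ω → κ → ℝ} {v : ℝ≥0}
    (hg : HasLaw g (gaussianReal 0 v) P) (hY : ∀ k, HasAllMoments (fun ω => Y ω k) P)
    (hgY : IndepFun g Y P) (A : Matrix d d ℝ) (B : κ → Matrix d d ℝ) (m : ℕ) :
    ∫ ω, g ω * (A * (g ω • A + ∑ k, Y ω k • B k) ^ m).trace ∂P =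
      v * ∫ ω, ∑ j ∈ Finset.range m,
        (A * ((g ω • A + ∑ k, Y ω k • B k) ^ (m.pred - j) * A *
          (g ω • A + ∑ k, Y ω k • B k) ^ j)).trace ∂P := by
  have hS : Continuous fun q : ℝ × (κ → ℝ) => q.1 • A + ∑ k, q.2 k • B k := by fun_prop
  have hf : Continuous fun q : ℝ × (κ → ℝ) => (A * (q.1 • A + ∑ k, q.2 k • B k) ^ m).trace :=
    (continuous_const.mul (hS.pow m)).matrix_trace
  have hf' : Continuous fun q : ℝ × (κ → ℝ) => ∑ j ∈ Finset.range m,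
      (A * ((q.1 • A + ∑ k, q.2 k • B k) ^ (m.pred - j) * A *
        (q.1 • A + ∑ k, q.2 k • B k) ^ j)).trace :=
    continuous_finsetSum _ fun j _ => (continuous_const.mul
      (((hS.pow _).mul continuous_const).mul (hS.pow j))).matrix_trace
  have hgm : HasAllMoments g P := hasAllMoments_of_hasLaw_gaussianReal hg
  have hX : MatrixHasAllMoments (fun ω => g ω • A + ∑ k, Y ω k • B k) P := by
    -- Indexing by `Option κ` treats the distinguished variable and the others as one series.
    have h := MatrixHasAllMoments.sum_smul (z := fun o : Option κ => o.elim g fun k ω => Y ω k)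
      (P := P) (fun o => by cases o with
        | none => exact hgm
        | some k => exact hY k) fun o => o.elim A B
    simpa only [Fintype.sum_option, Option.elim_none, Option.elim_some] using h
  have hA : MatrixHasAllMoments (fun _ : Ω => A) P := matrixHasAllMoments_const A
  have hi := (hA.mul (hX.pow m)).trace
  have hYm : AEMeasurable Y P :=
    aemeasurable_pi_lambda _ fun k => (hY k 1).aestronglyMeasurable.aemeasurable
  have hi' := (HasAllMoments.sum (s := Finset.range m) fun j _ =>
    (hA.mul (((hX.pow (m.pred - j)).mul hA).mul (hX.pow j))).trace).integrable
  refine integral_mul_of_indepFun_gaussianReal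
    (f := fun q => (A * (q.1 • A + ∑ k, q.2 k • B k) ^ m).trace)
    (f' := fun q => ∑ j ∈ Finset.range m, (A * ((q.1 • A + ∑ k, q.2 k • B k) ^ (m.pred - j) * A *
      (q.1 • A + ∑ k, q.2 k • B k) ^ j)).trace) hg hYm hgY ?_ ?_ ?_ ?_ ?_ ?_
  · exact fun x y => hasDerivAt_trace_mul_add_smul_pow A (∑ k, y k • B k) m x
  · exact hf.measurable
  · exact hf'.measurable
  · exact hi.integrable
  · exact hi'
  · exact (hgm.mul hi).integrable

variable {Ω ι : Type*} [MeasurableSpace Ω] {P : Measure Ω} [IsProbabilityMeasure P]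
  [Fintype ι] {z : ι → Ω → ℝ} {v : ι → ℝ≥0}

/-- Integration by parts in `z i`, with all other variables gathered into an independent vector. -/
theorem integral_mul_trace_mul_pow (hz : ∀ i, HasLaw (z i) (gaussianReal 0 (v i)) P)
    (hind : iIndepFun z P) (A : ι → Matrix d d ℝ) (i : ι) (m : ℕ) :
    ∫ ω, z i ω * (A i * (∑ k, z k ω • A k) ^ m).trace ∂P =
      v i * ∫ ω, ∑ j ∈ Finset.range m,
        (A i * ((∑ k, z k ω • A k) ^ (m.pred - j) * A i * (∑ k, z k ω • A k) ^ j)).trace ∂P := by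
  classical
  obtain ⟨T, hT⟩ : ∃ T : Finset ι, T = Finset.univ.erase i := ⟨_, rfl⟩
  have hgY : IndepFun (z i) (fun ω (k : T) => z k ω) P := by
    have h := hind.indepFun_finset₀ {i} T (by simp [hT]) fun k => (hz k).aemeasurable
    exact h.comp (φ := fun u : ({i} : Finset ι) → ℝ => u ⟨i, by simp⟩) (ψ := id)
      (measurable_pi_apply _) measurable_id
  have key := integral_mul_trace_mul_add_pow (hz i)
    (fun k : T => hasAllMoments_of_hasLaw_gaussianReal (hz k)) hgY (A i) (fun k : T => A k) m
  have hsum : ∀ ω, z i ω • A i + ∑ k : T, z k ω • A k = ∑ k, z k ω • A k := by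
    intro ω
    rw [← Finset.add_sum_erase _ _ (Finset.mem_univ i), ← hT,
      Finset.sum_coe_sort T fun k => z k ω • A k]
  simp only [hsum] at key
  exact key

/-- Expand one factor X = ∑ z_i A_i and integrate by parts. Each of the 2q + 1 resulting terms is at
most tr(A_i² X^(2q)), and the weighted sum of the A_i² is at most w in the semidefinite order. -/
theorem integral_trace_pow_add_two_le (hz : ∀ i, HasLaw (z i) (gaussianReal 0 (v i)) P)
    (hind : iIndepFun z P) {A : ι → Matrix d d ℝ} (hA : ∀ i, (A i).IsHermitian) {w : ℝ}
    (hw : (w • (1 : Matrix d d ℝ) - ∑ i, (v i : ℝ) • (A i * A i)).PosSemidef) (q : ℕ) :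
    ∫ ω, ((∑ k, z k ω • A k) ^ (2 * (q + 1))).trace ∂P ≤
      (2 * q + 1) * w * ∫ ω, ((∑ k, z k ω • A k) ^ (2 * q)).trace ∂P := by
  have hm : ∀ k, HasAllMoments (z k) P := fun k => hasAllMoments_of_hasLaw_gaussianReal (hz k)
  have hX := MatrixHasAllMoments.sum_smul hm A
  set X : Ω → Matrix d d ℝ := fun ω => ∑ k, z k ω • A k with hXdef
  have hXh : ∀ ω, (X ω).IsHermitian := fun ω =>
    isSelfAdjoint_sum _ fun k _ => (hA k).smul (IsSelfAdjoint.all (z k ω))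
  have hC : ∀ i, MatrixHasAllMoments (fun _ : Ω => A i) P := fun i => matrixHasAllMoments_const _
  have e1 : ∫ ω, (X ω ^ (2 * (q + 1))).trace ∂P =
      ∑ i, ∫ ω, z i ω * (A i * X ω ^ (2 * q + 1)).trace ∂P := by
    rw [← integral_finsetSum _ fun i _ => ((hm i).mul ((hC i).mul (hX.pow _)).trace).integrable]
    refine integral_congr_ae (Filter.Eventually.of_forall fun ω => ?_)
    simp only
    rw [show 2 * (q + 1) = (2 * q + 1) + 1 by ring, pow_succ']
    nth_rewrite 1 [hXdef]
    simp only [Finset.sum_mul, Matrix.trace_sum, Matrix.smul_mul, Matrix.trace_smul, smul_eq_mul]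
  have hterm : ∀ i j, HasAllMoments (fun ω =>
      (A i * (X ω ^ ((2 * q + 1).pred - j) * A i * X ω ^ j)).trace) P := fun i j =>
    ((hC i).mul (((hX.pow _).mul (hC i)).mul (hX.pow j))).trace
  have hterm' : ∀ i, HasAllMoments (fun ω => (A i * A i * X ω ^ (2 * q)).trace) P := fun i =>
    (((hC i).mul (hC i)).mul (hX.pow _)).trace
  have e2 : ∀ i, ∫ ω, z i ω * (A i * X ω ^ (2 * q + 1)).trace ∂P ≤
      v i * ∫ ω, (2 * q + 1) * (A i * A i * X ω ^ (2 * q)).trace ∂P := by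
    intro i
    rw [integral_mul_trace_mul_pow hz hind A i (2 * q + 1)]
    refine mul_le_mul_of_nonneg_left ?_ (v i).2
    refine integral_mono (HasAllMoments.sum fun j _ => hterm i j).integrable
      ((hterm' i).integrable.const_mul _) fun ω => ?_
    simp only
    have : ∀ j ∈ Finset.range (2 * q + 1),
        (A i * (X ω ^ ((2 * q + 1).pred - j) * A i * X ω ^ j)).trace ≤
          (A i * A i * X ω ^ (2 * q)).trace := by
      intro j hj
      have hj' : (2 * q + 1).pred - j + j = 2 * q := by
        have := Finset.mem_range.1 hj
        simp only [Nat.pred_eq_sub_one]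
        omega
      have := trace_mul_pow_mul_mul_pow_le (hA i) (hXh ω)
        (j := (2 * q + 1).pred - j) (l := j) (by rw [hj']; exact even_two_mul q)
      rw [hj'] at this
      simpa only [Matrix.mul_assoc] using this
    refine (Finset.sum_le_card_nsmul _ _ _ this).trans (le_of_eq ?_)
    simp
  rw [e1]
  calc _ ≤ ∑ i, (v i : ℝ) * ∫ ω, (2 * q + 1) * (A i * A i * X ω ^ (2 * q)).trace ∂P :=
        Finset.sum_le_sum fun i _ => e2 i
    _ = ∫ ω, (2 * q + 1) * ((∑ i, (v i : ℝ) • (A i * A i)) * X ω ^ (2 * q)).trace ∂P := by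
      simp only [← integral_const_mul]
      rw [← integral_finsetSum _ fun i _ => ((hterm' i).integrable.const_mul _).const_mul _]
      refine integral_congr_ae (Filter.Eventually.of_forall fun ω => ?_)
      simp only [Finset.sum_mul, Matrix.trace_sum, Matrix.smul_mul, Matrix.trace_smul, smul_eq_mul,
        Finset.mul_sum]
      exact Finset.sum_congr rfl fun i _ => by ring
    _ ≤ ∫ ω, (2 * q + 1) * w * (X ω ^ (2 * q)).trace ∂P := by
      refine integral_mono ?_ ((hX.pow _).trace.integrable.const_mul _) fun ω => ?_
      · exact (((matrixHasAllMoments_const _).mul (hX.pow _)).trace).integrable.const_mul _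
      · simp only
        rw [mul_assoc]
        exact mul_le_mul_of_nonneg_left (trace_mul_pow_le_of_posSemidef_sub hw (hXh ω) q)
          (by positivity)
    _ = _ := integral_const_mul _ _

/-- The even trace moments of a symmetric Gaussian matrix series. -/
theorem integral_trace_pow_le (hz : ∀ i, HasLaw (z i) (gaussianReal 0 (v i)) P)
    (hind : iIndepFun z P) {A : ι → Matrix d d ℝ} (hA : ∀ i, (A i).IsHermitian) {w : ℝ}
    (hw0 : 0 ≤ w)
    (hw : (w • (1 : Matrix d d ℝ) - ∑ i, (v i : ℝ) • (A i * A i)).PosSemidef) (p : ℕ) :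
    ∫ ω, ((∑ k, z k ω • A k) ^ (2 * p)).trace ∂P ≤
      (2 * p).factorial / (2 ^ p * p.factorial) * w ^ p * Fintype.card d := by
  induction p with
  | zero => simp
  | succ q ih =>
    refine (integral_trace_pow_add_two_le hz hind hA hw q).trans ?_
    refine (mul_le_mul_of_nonneg_left ih (by positivity)).trans (le_of_eq ?_)
    -- The coefficient (2p)!/(2^p p!) is (2p-1)!!, which gains exactly the factor 2q + 1.
    rw [show 2 * (q + 1) = 2 * q + 1 + 1 by ring, Nat.factorial_succ, Nat.factorial_succ,
      Nat.factorial_succ]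
    push_cast
    field_simp
    ring

end GaussianSeries

/-! ### Hermitian dilation and the norm tail bound. -/

section Tail

theorem isHermitian_dilation {n : ℕ} (M : Matrix (Fin n) (Fin n) ℝ) :
    (Matrix.fromBlocks 0 M Mᵀ 0).IsHermitian := by
  rw [Matrix.IsHermitian, Matrix.conjTranspose_eq_transpose_of_trivial, Matrix.fromBlocks_transpose]
  simp

theorem dilation_mul_self {n : ℕ} (M : Matrix (Fin n) (Fin n) ℝ) :
    Matrix.fromBlocks 0 M Mᵀ 0 * Matrix.fromBlocks 0 M Mᵀ 0 =
      Matrix.fromBlocks (M * Mᵀ) 0 0 (Mᵀ * M) := by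
  simp [Matrix.fromBlocks_multiply]

/-- Both diagonal blocks M Mᵀ and Mᵀ M of the squared dilation contribute ‖M‖^(2p). The resulting 2
later compensates for the doubled dimension. -/
theorem two_mul_opNorm_pow_le_trace_dilation {n : ℕ} (hn : 0 < n) (M : Matrix (Fin n) (Fin n) ℝ)
    (p : ℕ) : 2 * opNorm M ^ (2 * p) ≤ ((Matrix.fromBlocks 0 M Mᵀ 0) ^ (2 * p)).trace := by
  rw [pow_mul (Matrix.fromBlocks 0 M Mᵀ 0), pow_two, dilation_mul_self,
    Matrix.fromBlocks_diagonal_pow, Matrix.trace, Fintype.sum_sum_type]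
  change _ ≤ ((M * Mᵀ) ^ p).trace + ((Mᵀ * M) ^ p).trace
  have h1 := opNorm_pow_le_trace hn M p
  have h2 := opNorm_pow_le_trace hn Mᵀ p
  rw [opNorm_transpose, Matrix.transpose_transpose] at h2
  linarith

variable {Ω ι : Type*} [MeasurableSpace Ω] {P : Measure Ω} [IsProbabilityMeasure P]
  [Fintype ι] {z : ι → Ω → ℝ} {v : ι → ℝ≥0} {n : ℕ}

theorem fromBlocks_sum_smul (c : ι → ℝ) (D : ι → Matrix (Fin n) (Fin n) ℝ) :
    ∑ i, c i • Matrix.fromBlocks 0 (D i) (D i)ᵀ 0 =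
      Matrix.fromBlocks 0 (∑ i, c i • D i) (∑ i, c i • D i)ᵀ 0 := by
  ext a b
  rcases a with a | a <;> rcases b with b | b <;> simp [Matrix.sum_apply]

/-- The variance of the dilated series is block diagonal, which is why the maximum of two norms
governs the tail. -/
theorem posSemidef_smul_one_sub_sum_dilation {D : ι → Matrix (Fin n) (Fin n) ℝ} {w : ℝ}
    (h1 : opNorm (∑ i, (v i : ℝ) • (D i * (D i)ᵀ)) ≤ w)
    (h2 : opNorm (∑ i, (v i : ℝ) • ((D i)ᵀ * D i)) ≤ w) :
    (w • (1 : Matrix (Fin n ⊕ Fin n) (Fin n ⊕ Fin n) ℝ) - ∑ i, (v i : ℝ) •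
      (Matrix.fromBlocks 0 (D i) (D i)ᵀ 0 * Matrix.fromBlocks 0 (D i) (D i)ᵀ 0)).PosSemidef := by
  have hsum : ∀ E : ι → Matrix (Fin n) (Fin n) ℝ, (∀ i, (E i)ᴴ = E i) →
      (∑ i, (v i : ℝ) • E i).IsHermitian := fun E hE =>
    isSelfAdjoint_sum _ fun i _ => (IsSelfAdjoint.all (v i : ℝ)).smul (hE i)
  have p1 := posSemidef_smul_one_sub (hsum _ fun i => by
    rw [Matrix.conjTranspose_eq_transpose_of_trivial]; simp) h1
  have p2 := posSemidef_smul_one_sub (hsum _ fun i => by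
    rw [Matrix.conjTranspose_eq_transpose_of_trivial]; simp) h2
  have e : w • (1 : Matrix (Fin n ⊕ Fin n) (Fin n ⊕ Fin n) ℝ) - ∑ i, (v i : ℝ) •
      (Matrix.fromBlocks 0 (D i) (D i)ᵀ 0 * Matrix.fromBlocks 0 (D i) (D i)ᵀ 0) =
      Matrix.fromBlocks (w • 1 - ∑ i, (v i : ℝ) • (D i * (D i)ᵀ)) 0 0
        (w • 1 - ∑ i, (v i : ℝ) • ((D i)ᵀ * D i)) := by
    simp only [dilation_mul_self]
    ext a b
    rcases a with a | a <;> rcases b with b | b <;> simp [Matrix.sum_apply, Matrix.one_apply]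
  rw [e]
  refine Matrix.PosSemidef.of_dotProduct_mulVec_nonneg ?_ fun x => ?_
  · exact Matrix.IsHermitian.fromBlocks p1.1 (by simp) p2.1
  · have q1 := p1.dotProduct_mulVec_nonneg (x ∘ Sum.inl)
    have q2 := p2.dotProduct_mulVec_nonneg (x ∘ Sum.inr)
    rw [Matrix.fromBlocks_mulVec]
    simp only [Matrix.zero_mulVec, add_zero, zero_add, dotProduct, Fintype.sum_sum_type,
      Sum.elim_inl, Sum.elim_inr] at q1 q2 ⊢
    exact add_nonneg q1 q2

/-- Moment form of the tail bound for Gaussian matrix series. -/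
theorem pow_mul_measureReal_opNorm_ge_le (hn : 0 < n)
    (hz : ∀ i, HasLaw (z i) (gaussianReal 0 (v i)) P)
    (hind : iIndepFun z P) {D : ι → Matrix (Fin n) (Fin n) ℝ} {w : ℝ}
    (h1 : opNorm (∑ i, (v i : ℝ) • (D i * (D i)ᵀ)) ≤ w)
    (h2 : opNorm (∑ i, (v i : ℝ) • ((D i)ᵀ * D i)) ≤ w) {t : ℝ} (ht : 0 ≤ t) (p : ℕ) :
    t ^ (2 * p) * P.real {ω | t ≤ opNorm (∑ i, z i ω • D i)} ≤
      (2 * p).factorial / (2 ^ p * p.factorial) * w ^ p * n := by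
  have hm : ∀ k, HasAllMoments (z k) P := fun k => hasAllMoments_of_hasLaw_gaussianReal (hz k)
  have hX := MatrixHasAllMoments.sum_smul hm fun i => Matrix.fromBlocks 0 (D i) (D i)ᵀ 0
  have hmom := integral_trace_pow_le hz hind (fun i => isHermitian_dilation (D i))
    ((opNorm_nonneg _).trans h1) (posSemidef_smul_one_sub_sum_dilation h1 h2) p
  have hint := (hX.pow (2 * p)).trace.integrable
  simp only [fromBlocks_sum_smul] at hmom hint
  have hge : ∀ ω, 2 * opNorm (∑ i, z i ω • D i) ^ (2 * p) ≤ _ := fun ω =>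
    two_mul_opNorm_pow_le_trace_dilation hn (∑ i, z i ω • D i) p
  have mk := mul_meas_ge_le_integral_of_nonneg (Filter.Eventually.of_forall fun ω =>
    (mul_nonneg zero_le_two (pow_nonneg (opNorm_nonneg _) _)).trans (hge ω)) hint (2 * t ^ (2 * p))
  have mono : P.real {ω | t ≤ opNorm (∑ i, z i ω • D i)} ≤ P.real {ω | 2 * t ^ (2 * p) ≤
      ((Matrix.fromBlocks 0 (∑ i, z i ω • D i) (∑ i, z i ω • D i)ᵀ 0) ^ (2 * p)).trace} := by
    refine measureReal_mono fun ω hω => ?_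
    have h := pow_le_pow_left₀ ht (show t ≤ _ from hω) (2 * p)
    exact (mul_le_mul_of_nonneg_left h zero_le_two).trans (hge ω)
  have h3 := mul_le_mul_of_nonneg_left mono (show 0 ≤ 2 * t ^ (2 * p) by positivity)
  rw [Fintype.card_sum, Fintype.card_fin, Nat.cast_add] at hmom
  nlinarith [h3.trans (mk.trans hmom)]

/-- The tail bound for Gaussian matrix series. -/
theorem measureReal_opNorm_ge_le (hn : 0 < n)
    (hz : ∀ i, HasLaw (z i) (gaussianReal 0 (v i)) P)
    (hind : iIndepFun z P) {D : ι → Matrix (Fin n) (Fin n) ℝ} {w : ℝ} (hw : 0 < w)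
    (h1 : opNorm (∑ i, (v i : ℝ) • (D i * (D i)ᵀ)) ≤ w)
    (h2 : opNorm (∑ i, (v i : ℝ) • ((D i)ᵀ * D i)) ≤ w) {t : ℝ} (ht : 0 ≤ t) :
    P.real {ω | t ≤ opNorm (∑ i, z i ω • D i)} ≤ 2 * n * Real.exp (-t ^ 2 / (2 * w)) := by
  set pr := P.real {ω | t ≤ opNorm (∑ i, z i ω • D i)} with hpr
  have hpr0 : 0 ≤ pr := measureReal_nonneg
  -- The p-th moment bound is weighted by (t/w)^(2p)/(2p)!. Summed over p, the left side becomes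
  -- cosh(t²/w) · pr and the right side n · exp(t²/(2w)).
  have s1 := (Real.hasSum_cosh (t / w * t)).mul_right pr
  have s2 : HasSum (fun p : ℕ => (t ^ 2 / (2 * w)) ^ p / p.factorial * n)
      (Real.exp (t ^ 2 / (2 * w)) * n) := by
    rw [Real.exp_eq_exp_ℝ]
    have h := NormedSpace.expSeries_div_hasSum_exp (𝔸 := ℝ) (t ^ 2 / (2 * w))
    exact h.mul_right _
  have hle : Real.cosh (t / w * t) * pr ≤ Real.exp (t ^ 2 / (2 * w)) * n := by
    refine hasSum_le (fun p => ?_) s1 s2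
    have h := pow_mul_measureReal_opNorm_ge_le hn hz hind h1 h2 ht p
    have h' := mul_le_mul_of_nonneg_left h
      (show 0 ≤ (t / w) ^ (2 * p) / (2 * p).factorial by positivity)
    calc _ = (t / w) ^ (2 * p) / (2 * p).factorial * (t ^ (2 * p) * pr) := by
          rw [mul_pow]; ring
      _ ≤ _ := h'
      _ = _ := by
        rw [div_pow, div_pow, mul_pow, pow_mul w, pow_mul t, pow_two w, mul_pow]
        field_simp
  have hcosh : Real.exp (t / w * t) ≤ 2 * Real.cosh (t / w * t) := by
    rw [Real.cosh_eq]
    linarith [Real.exp_pos (-(t / w * t))]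
  have h3 : Real.exp (t / w * t) * pr ≤ 2 * n * Real.exp (t ^ 2 / (2 * w)) := by
    nlinarith [mul_le_mul_of_nonneg_right hcosh hpr0]
  have e : Real.exp (-t ^ 2 / (2 * w)) = Real.exp (t ^ 2 / (2 * w)) / Real.exp (t / w * t) := by
    rw [← Real.exp_sub]
    congr 1
    field_simp
    ring
  rw [e, ← mul_div_assoc, le_div_iff₀ (Real.exp_pos _)]
  linarith

end Tail

/-! ### Spectral radius, trace and eigenvalue perturbation. -/

section Spectral

open scoped Matrix.Norms.L2Operator

variable {n : ℕ}

/-- Needed because `rho` is a `toReal`, which would send ⊤ to 0. -/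
theorem spectralRadius_ne_top (hn : 0 < n) (M : Matrix (Fin n) (Fin n) ℂ) :
    spectralRadius ℂ M ≠ ⊤ := by
  have : Nonempty (Fin n) := ⟨⟨0, hn⟩⟩
  exact ((spectrum.spectralRadius_le_nnnorm (𝕜 := ℂ) M).trans_lt ENNReal.coe_lt_top).ne

theorem norm_le_rho (hn : 0 < n) {M : Matrix (Fin n) (Fin n) ℝ} {k : ℂ}
    (hk : k ∈ spectrum ℂ (M.map (algebraMap ℝ ℂ))) : ‖k‖ ≤ rho M := by
  have h : (‖k‖₊ : ENNReal) ≤ spectralRadius ℂ (M.map (algebraMap ℝ ℂ)) :=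
    le_iSup₂ (f := fun (k : ℂ) (_ : k ∈ spectrum ℂ (M.map (algebraMap ℝ ℂ))) =>
      (‖k‖₊ : ENNReal)) k hk
  exact ENNReal.toReal_mono (spectralRadius_ne_top hn _) h

theorem exists_mem_spectrum_norm_eq_rho (hn : 0 < n) (M : Matrix (Fin n) (Fin n) ℝ) :
    ∃ k ∈ spectrum ℂ (M.map (algebraMap ℝ ℂ)), ‖k‖ = rho M := by
  have : Nonempty (Fin n) := ⟨⟨0, hn⟩⟩
  obtain ⟨k, hk, h⟩ := spectrum.exists_nnnorm_eq_spectralRadius (M.map (algebraMap ℝ ℂ))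
  exact ⟨k, hk, by rw [rho, ← h]; simp⟩

/-- The trace is at most the dimension times the spectral radius. -/
theorem abs_trace_le_mul_rho (hn : 0 < n) (M : Matrix (Fin n) (Fin n) ℝ) :
    |M.trace| ≤ n * rho M := by
  set C := M.map (algebraMap ℝ ℂ) with hC
  have h1 : ((M.trace : ℝ) : ℂ) = C.trace := by simp [hC, Matrix.trace]
  have h2 : ‖C.trace‖ ≤ n * rho M := by
    rw [Matrix.trace_eq_sum_roots_charpoly]
    have hle : ∀ s : Multiset ℂ, (∀ k ∈ s, ‖k‖ ≤ rho M) → ‖s.sum‖ ≤ s.card * rho M := by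
      intro s
      induction s using Multiset.induction_on with
      | empty => simp
      | cons a s ih =>
        intro h
        rw [Multiset.sum_cons, Multiset.card_cons]
        refine (norm_add_le _ _).trans ?_
        have h3 := h a (Multiset.mem_cons_self a s)
        have h4 := ih fun k hk => h k (Multiset.mem_cons_of_mem hk)
        push_cast
        linarith
    have hr : 0 ≤ rho M := ENNReal.toReal_nonneg
    refine (hle _ fun k hk => norm_le_rho hn ?_).trans ?_
    · exact Matrix.mem_spectrum_of_isRoot_charpoly ((Polynomial.mem_roots'.1 hk).2)
    · refine mul_le_mul_of_nonneg_right ?_ hr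
      have := C.charpoly.card_roots'
      rw [Matrix.charpoly_natDegree_eq_dim, Fintype.card_fin] at this
      exact_mod_cast this
  rwa [← h1, Complex.norm_real, Real.norm_eq_abs] at h2

/-- A real matrix acts separately on real and imaginary parts, whose squared norms add. -/
theorem opNorm_map_algebraMap_le (M : Matrix (Fin n) (Fin n) ℝ) :
    opNorm (M.map (algebraMap ℝ ℂ)) ≤ opNorm M := by
  rw [opNorm, ← Matrix.l2_opNorm_toEuclideanCLM]
  refine ContinuousLinearMap.opNorm_le_bound _ (opNorm_nonneg M) fun x => ?_
  have split : ∀ u : EuclideanSpace ℂ (Fin n), ‖u‖ ^ 2 =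
      ‖WithLp.toLp 2 fun j => (u j).re‖ ^ 2 + ‖WithLp.toLp 2 fun j => (u j).im‖ ^ 2 := by
    intro u
    simp only [EuclideanSpace.norm_sq_eq, ← Finset.sum_add_distrib]
    refine Finset.sum_congr rfl fun j _ => ?_
    rw [Complex.sq_norm, Complex.normSq_apply, Real.norm_eq_abs, Real.norm_eq_abs, sq_abs, sq_abs]
    ring
  set y := Matrix.toEuclideanCLM (n := Fin n) (𝕜 := ℂ) (M.map (algebraMap ℝ ℂ)) x with hy
  have hre : (fun j => (y j).re) = M *ᵥ fun j => (x j).re := by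
    ext j
    simp [hy, Matrix.mulVec, dotProduct]
  have him : (fun j => (y j).im) = M *ᵥ fun j => (x j).im := by
    ext j
    simp [hy, Matrix.mulVec, dotProduct]
  have h1 : ‖WithLp.toLp 2 (M *ᵥ fun j => (x j).re)‖ ≤ opNorm M * _ :=
    Matrix.l2_opNorm_mulVec M (WithLp.toLp 2 fun j => (x j).re)
  have h2 : ‖WithLp.toLp 2 (M *ᵥ fun j => (x j).im)‖ ≤ opNorm M * _ :=
    Matrix.l2_opNorm_mulVec M (WithLp.toLp 2 fun j => (x j).im)
  refine (abs_le_of_sq_le_sq' ?_ (mul_nonneg (opNorm_nonneg M) (norm_nonneg _))).2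
  rw [mul_pow, split y, split x, hre, him, mul_add, ← mul_pow, ← mul_pow]
  exact add_le_add (pow_le_pow_left₀ (norm_nonneg _) h1 2) (pow_le_pow_left₀ (norm_nonneg _) h2 2)

theorem mul_norm_le_of_forall_mul_norm_le {c : ℝ} (hc : 0 ≤ c) {x y : EuclideanSpace ℂ (Fin n)}
    (h : ∀ i, c * ‖x i‖ ≤ ‖y i‖) : c * ‖x‖ ≤ ‖y‖ := by
  refine abs_le_of_sq_le_sq' ?_ (norm_nonneg _) |>.2
  rw [mul_pow, EuclideanSpace.norm_sq_eq, EuclideanSpace.norm_sq_eq, Finset.mul_sum]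
  refine Finset.sum_le_sum fun i _ => ?_
  rw [← mul_pow]
  exact pow_le_pow_left₀ (by positivity) (h i) 2

theorem norm_eigenvalue_le_rho (hn : 0 < n) {A : Matrix (Fin n) (Fin n) ℝ}
    {V : Matrix (Fin n) (Fin n) ℂ} (hV : IsUnit V) {d : Fin n → ℂ}
    (hd : A.map (algebraMap ℝ ℂ) * V = V * Matrix.diagonal d) (i : Fin n) : ‖d i‖ ≤ rho A := by
  refine norm_le_rho hn ?_
  obtain ⟨u, rfl⟩ := hV
  have h : A.map (algebraMap ℝ ℂ) =
      (u : Matrix (Fin n) (Fin n) ℂ) * Matrix.diagonal d * ((u⁻¹ : (Matrix (Fin n) (Fin n) ℂ)ˣ) : Matrix (Fin n) (Fin n) ℂ) := by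
    rw [← hd, mul_assoc, Units.mul_inv, mul_one]
  rw [h, spectrum.units_conjugate, spectrum_diagonal]
  exact ⟨i, rfl⟩

/-- The Bauer-Fike bound, in terms of the spectral radius. -/
theorem norm_sub_rho_le_condNumber_mul (hn : 0 < n) {A E : Matrix (Fin n) (Fin n) ℝ}
    {V : Matrix (Fin n) (Fin n) ℂ} (hV : IsEigenvectorMatrix A V) {k : ℂ}
    (hk : k ∈ spectrum ℂ ((A + E).map (algebraMap ℝ ℂ))) :
    ‖k‖ - rho A ≤ condNumber V * opNorm E := by
  obtain ⟨hu, d, hd⟩ := hV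
  rcases le_total (‖k‖ - rho A) 0 with hneg | hpos
  · exact hneg.trans (mul_nonneg (mul_nonneg (opNorm_nonneg _) (opNorm_nonneg _)) (opNorm_nonneg _))
  have hdet : IsUnit V.det := (Matrix.isUnit_iff_isUnit_det V).1 hu
  rw [spectrum.mem_iff, Matrix.isUnit_iff_isUnit_det, isUnit_iff_ne_zero, not_not,
    ← Matrix.exists_mulVec_eq_zero_iff] at hk
  obtain ⟨x, hx0, hx⟩ := hk
  -- In eigenvector coordinates the eigenvalue equation reads (k - d_i) y_i = (G y)_i. Since |k -
  -- d_i| ≥ |k| - ρ(A) for every i, comparing Euclidean norms gives |k| - ρ(A) ≤ ‖G‖.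
  set y := V⁻¹ *ᵥ x with hy
  have hxy : x = V *ᵥ y := by
    rw [hy, Matrix.mulVec_mulVec, Matrix.mul_nonsing_inv _ hdet, Matrix.one_mulVec]
  have hy0 : y ≠ 0 := by
    intro h
    exact hx0 (by rw [hxy, h, Matrix.mulVec_zero])
  set G := V⁻¹ * E.map (algebraMap ℝ ℂ) * V with hG
  have heq : ∀ i, (k - d i) * y i = (G *ᵥ y) i := by
    have h1 : V⁻¹ *ᵥ ((algebraMap ℂ (Matrix (Fin n) (Fin n) ℂ) k -
        (A + E).map (algebraMap ℝ ℂ)) *ᵥ x) = 0 := by rw [hx, Matrix.mulVec_zero]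
    rw [hxy, Matrix.mulVec_mulVec, Matrix.mulVec_mulVec, Matrix.map_add _ (by simp)] at h1
    have h2 : V⁻¹ * (algebraMap ℂ (Matrix (Fin n) (Fin n) ℂ) k -
        (A.map (algebraMap ℝ ℂ) + E.map (algebraMap ℝ ℂ))) * V =
        k • (1 : Matrix (Fin n) (Fin n) ℂ) - Matrix.diagonal d - G := by
      rw [Algebra.algebraMap_eq_smul_one, ← sub_sub, mul_assoc, sub_mul, sub_mul, hd, mul_sub,
        mul_sub, ← mul_assoc V⁻¹ V, Matrix.nonsing_inv_mul _ hdet, one_mul, smul_mul_assoc, one_mul,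
        mul_smul_comm, Matrix.nonsing_inv_mul _ hdet, hG, mul_assoc]
    rw [h2, Matrix.sub_mulVec, Matrix.sub_mulVec, Matrix.smul_mulVec, Matrix.one_mulVec] at h1
    intro i
    have h3 := congrFun h1 i
    simp only [Pi.sub_apply, Pi.smul_apply, Matrix.mulVec_diagonal, smul_eq_mul,
      Pi.zero_apply] at h3
    linear_combination h3
  have h1 : (‖k‖ - rho A) * ‖WithLp.toLp 2 y‖ ≤ ‖WithLp.toLp 2 (G *ᵥ y)‖ := by
    refine mul_norm_le_of_forall_mul_norm_le hpos fun i => ?_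
    simp only
    rw [← heq i, norm_mul]
    refine mul_le_mul_of_nonneg_right ?_ (norm_nonneg _)
    have := norm_sub_norm_le k (d i)
    have := norm_eigenvalue_le_rho hn hu hd i
    linarith
  have h2 : ‖WithLp.toLp 2 (G *ᵥ y)‖ ≤ ‖G‖ * ‖WithLp.toLp 2 y‖ :=
    Matrix.l2_opNorm_mulVec G (WithLp.toLp 2 y)
  have hy' : 0 < ‖WithLp.toLp 2 y‖ := by
    rw [norm_pos_iff]
    intro h
    exact hy0 (congrArg WithLp.ofLp h)
  have h3 : ‖G‖ ≤ opNorm V⁻¹ * opNorm E * opNorm V := by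
    refine (Matrix.l2_opNorm_mul _ _).trans (mul_le_mul_of_nonneg_right ?_ (norm_nonneg _))
    exact (Matrix.l2_opNorm_mul _ _).trans
      (mul_le_mul_of_nonneg_left (opNorm_map_algebraMap_le E) (norm_nonneg _))
  have h4 := le_of_mul_le_mul_right (h1.trans h2) hy'
  rw [condNumber]
  linarith

theorem condNumber_pos (hn : 0 < n) {V : Matrix (Fin n) (Fin n) ℂ} (hV : IsUnit V) :
    0 < condNumber V := by
  have : Nonempty (Fin n) := ⟨⟨0, hn⟩⟩
  have hdet : IsUnit V.det := (Matrix.isUnit_iff_isUnit_det V).1 hV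
  have h1 : V * V⁻¹ = 1 := Matrix.mul_nonsing_inv _ hdet
  have hV0 : V ≠ 0 := fun h => by simp [h] at h1
  have hV1 : V⁻¹ ≠ 0 := fun h => by simp [h] at h1
  exact mul_pos (norm_pos_iff.2 hV0) (norm_pos_iff.2 hV1)

end Spectral

/-! ### Linear combinations of Gaussians and their two-sided tails. -/

section GaussianTail

variable {Ω ι : Type*} [MeasurableSpace Ω] {P : Measure Ω} [IsProbabilityMeasure P]
  [Fintype ι] {z : ι → Ω → ℝ} {v : ι → ℝ≥0}

/-- Characteristic functions of independent summands multiply, so the Gaussian exponents add. -/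
theorem hasLaw_sum_mul_gaussianReal (hz : ∀ i, HasLaw (z i) (gaussianReal 0 (v i)) P)
    (hind : iIndepFun z P) (c : ι → ℝ) {s : ℝ≥0} (hs : (s : ℝ) = ∑ i, v i * c i ^ 2) :
    HasLaw (fun ω => ∑ i, z i ω * c i) (gaussianReal 0 s) P := by
  have hl := fun i => gaussianReal_mul_const (hz i) (c i)
  have hind' : iIndepFun (fun i ω => z i ω * c i) P :=
    hind.comp (fun i x => x * c i) fun i => measurable_mul_const _
  have hm : AEMeasurable (fun ω => ∑ i, z i ω * c i) P :=
    Finset.aemeasurable_fun_sum _ fun i _ => (hl i).aemeasurable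
  have : IsProbabilityMeasure (P.map fun ω => ∑ i, z i ω * c i) :=
    Measure.isProbabilityMeasure_map hm
  refine ⟨hm, Measure.ext_of_charFun ?_⟩
  rw [iIndepFun.charFun_map_fun_sum_eq_prod (fun i => (hl i).aemeasurable) hind']
  ext t
  simp only [Finset.prod_apply, (hl _).map_eq, charFun_gaussianReal]
  rw [← Complex.exp_sum]
  congr 1
  have hs' : (s : ℂ) = ∑ i, (v i : ℂ) * (c i : ℂ) ^ 2 := by
    have := congrArg (fun r : ℝ => (r : ℂ)) hs
    push_cast at this
    exact this
  simp only [NNReal.coe_mul, NNReal.coe_mk, hs']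
  push_cast
  rw [Finset.sum_mul, Finset.sum_div]
  simp only [mul_zero, zero_mul, zero_sub, Finset.sum_neg_distrib]
  congr 1
  exact Finset.sum_congr rfl fun i _ => by ring

theorem Q_add_Q_le {W : Ω → ℝ} {s : ℝ≥0} (hs : 0 < s) (hW : HasLaw W (gaussianReal 0 s) P)
    {a b : ℝ} (hab : 0 < a + b) {E : Set Ω} (h1 : ∀ ω, b ≤ W ω → ω ∈ E)
    (h2 : ∀ ω, W ω ≤ -a → ω ∈ E) :
    Q (a / √s) + Q (b / √s) ≤ P.real E := by
  have hs' : 0 < √(s : ℝ) := Real.sqrt_pos.2 (by exact_mod_cast hs)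
  have hG : HasLaw (fun ω => W ω / √(s : ℝ)) (gaussianReal 0 1) P := by
    have h := gaussianReal_div_const hW (√(s : ℝ))
    convert h using 2
    · simp
    · ext
      simp only [NNReal.coe_one, NNReal.coe_div, NNReal.coe_mk]
      rw [Real.sq_sqrt s.coe_nonneg, div_self (by exact_mod_cast hs.ne')]
  -- Symmetry turns this term into a lower tail; a + b > 0 makes it disjoint from the upper tail, so
  -- the two probabilities add.
  have hneg : Q (a / √s) = (gaussianReal 0 1).real (Set.Iio (-(a / √s))) := by
    have h := gaussianReal_map_neg (μ := 0) (v := 1)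
    rw [neg_zero] at h
    rw [Q, measureReal_def, measureReal_def]
    nth_rewrite 1 [← h]
    rw [Measure.map_apply measurable_neg measurableSet_Ioi]
    congr 2
    ext x
    simp only [Set.mem_preimage, Set.mem_Ioi, Set.mem_Iio]
    constructor <;> intro <;> linarith
  have hdisj : Disjoint (Set.Iio (-(a / √s))) (Set.Ioi (b / √s)) := by
    rw [Set.disjoint_left]
    intro x hx hx'
    have : 0 < a / √s + b / √s := by rw [← add_div]; positivity
    simp only [Set.mem_Iio, Set.mem_Ioi] at hx hx'
    linarith
  rw [hneg, Q, ← measureReal_union hdisj measurableSet_Ioi, ← hG.map_eq, measureReal_def,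
    Measure.map_apply_of_aemeasurable hG.aemeasurable (measurableSet_Iio.union measurableSet_Ioi),
    ← measureReal_def]
  refine measureReal_mono fun ω hω => ?_
  rcases hω with hω | hω
  · refine h2 ω ?_
    have : W ω / √s < -(a / √s) := hω
    rw [← neg_div, div_lt_div_iff_of_pos_right hs'] at this
    exact this.le
  · refine h1 ω ?_
    have : b / √s < W ω / √s := hω
    rw [div_lt_div_iff_of_pos_right hs'] at this
    exact this.le

end GaussianTail

/-! ### Bounds for the perturbed closed-loop matrix. -/

section Perturbation

variable {n : ℕ} {κ : Type*} {A : Matrix (Fin n) (Fin n) ℝ} {S : Finset κ}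
  {D : κ → Matrix (Fin n) (Fin n) ℝ}

theorem perturbed_eq_add_sum_subtype (c : κ → ℝ) :
    perturbed A S c D = A + ∑ i : {i // i ∈ S}, c i • D i := by
  rw [perturbed, Finset.sum_coe_sort S fun i => c i • D i]

theorem le_opNorm_of_one_le_rho_perturbed (hn : 0 < n) {V : Matrix (Fin n) (Fin n) ℂ}
    (hV : IsEigenvectorMatrix A V) {c : κ → ℝ} (h : 1 ≤ rho (perturbed A S c D)) :
    (1 - rho A) / condNumber V ≤ opNorm (∑ i : {i // i ∈ S}, c i • D i) := by
  rw [perturbed_eq_add_sum_subtype] at h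
  obtain ⟨k, hk, hkr⟩ := exists_mem_spectrum_norm_eq_rho hn (A + ∑ i : {i // i ∈ S}, c i • D i)
  have := norm_sub_rho_le_condNumber_mul hn hV hk
  rw [div_le_iff₀' (condNumber_pos hn hV.1)]
  linarith

variable {Ω : Type*} [MeasurableSpace Ω] {P : Measure Ω} [IsProbabilityMeasure P]
  {z : κ → Ω → ℝ} {σ : κ → ℝ≥0}

theorem opNorm_sum_mul_transpose_le_vUpper :
    opNorm (∑ i : {i // i ∈ S}, ((σ i ^ 2 : ℝ≥0) : ℝ) • (D i * (D i)ᵀ)) ≤ vUpper S σ D := by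
  rw [Finset.sum_coe_sort S fun i => ((σ i ^ 2 : ℝ≥0) : ℝ) • (D i * (D i)ᵀ)]
  exact le_max_left _ _

theorem opNorm_sum_transpose_mul_le_vUpper :
    opNorm (∑ i : {i // i ∈ S}, ((σ i ^ 2 : ℝ≥0) : ℝ) • ((D i)ᵀ * D i)) ≤ vUpper S σ D := by
  rw [Finset.sum_coe_sort S fun i => ((σ i ^ 2 : ℝ≥0) : ℝ) • ((D i)ᵀ * D i)]
  exact le_max_right _ _

theorem measureReal_one_le_rho_perturbed_le (hn : 0 < n) (hA : rho A < 1)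
    (hz : ∀ i ∈ S, HasLaw (z i) (gaussianReal 0 (σ i ^ 2)) P)
    (hind : iIndepFun (fun i : {i // i ∈ S} => z i) P) (hv : 0 < vUpper S σ D)
    {V : Matrix (Fin n) (Fin n) ℂ} (hV : IsEigenvectorMatrix A V) :
    P.real {ω | 1 ≤ rho (perturbed A S (fun i => z i ω) D)} ≤
      2 * n * Real.exp (-(1 - rho A) ^ 2 / (2 * vUpper S σ D * condNumber V ^ 2)) := by
  have h := measureReal_opNorm_ge_le hn (fun i : {i // i ∈ S} => hz i i.2) hind hv
    opNorm_sum_mul_transpose_le_vUpper opNorm_sum_transpose_mul_le_vUpper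
    (div_nonneg (sub_nonneg.2 hA.le) (condNumber_pos hn hV.1).le)
  refine (measureReal_mono fun ω hω => le_opNorm_of_one_le_rho_perturbed hn hV hω).trans
    (h.trans (le_of_eq ?_))
  have := (condNumber_pos hn hV.1).ne'
  congr 2
  rw [div_pow]
  field_simp

/-- The exponential bound is meaningless at zero variance; the second moment (p = 1) already gives
t² P ≤ 0 with t > 0. -/
theorem measureReal_one_le_rho_perturbed_eq_zero (hn : 0 < n) (hA : rho A < 1)
    (hz : ∀ i ∈ S, HasLaw (z i) (gaussianReal 0 (σ i ^ 2)) P)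
    (hind : iIndepFun (fun i : {i // i ∈ S} => z i) P) (hv : vUpper S σ D = 0)
    {V : Matrix (Fin n) (Fin n) ℂ} (hV : IsEigenvectorMatrix A V) :
    P.real {ω | 1 ≤ rho (perturbed A S (fun i => z i ω) D)} = 0 := by
  have ht : 0 < (1 - rho A) / condNumber V := div_pos (sub_pos.2 hA) (condNumber_pos hn hV.1)
  have h := pow_mul_measureReal_opNorm_ge_le hn (fun i : {i // i ∈ S} => hz i i.2) hind
    (opNorm_sum_mul_transpose_le_vUpper (D := D)) opNorm_sum_transpose_mul_le_vUpper ht.le 1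
  rw [hv, pow_one (0 : ℝ), mul_zero, zero_mul] at h
  refine le_antisymm ((measureReal_mono fun ω hω =>
    le_opNorm_of_one_le_rho_perturbed hn hV hω).trans ?_) measureReal_nonneg
  exact nonpos_of_mul_nonpos_right h (by positivity)

theorem Q_add_Q_le_measureReal_one_le_rho_perturbed (hn : 0 < n)
    (hz : ∀ i ∈ S, HasLaw (z i) (gaussianReal 0 (σ i ^ 2)) P)
    (hind : iIndepFun (fun i : {i // i ∈ S} => z i) P) (hv : 0 < vLower S σ D) :
    Q ((n + A.trace) / √(vLower S σ D)) + Q ((n - A.trace) / √(vLower S σ D)) ≤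
      P.real {ω | 1 ≤ rho (perturbed A S (fun i => z i ω) D)} := by
  lift vLower S σ D to ℝ≥0 using hv.le with s hs
  have hs' : (s : ℝ) = ∑ i : {i // i ∈ S}, ((σ i ^ 2 : ℝ≥0) : ℝ) * (D i).trace ^ 2 := by
    rw [hs, Finset.sum_coe_sort S fun i => ((σ i ^ 2 : ℝ≥0) : ℝ) * (D i).trace ^ 2]
    simp [vLower]
  have hW := hasLaw_sum_mul_gaussianReal (fun i : {i // i ∈ S} => hz i i.2) hind
    (fun i => (D i).trace) hs'
  have hn' : (0 : ℝ) < n := by exact_mod_cast hn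
  have htr : ∀ ω, (perturbed A S (fun i => z i ω) D).trace =
      A.trace + ∑ i : {i // i ∈ S}, z i ω * (D i).trace := by
    intro ω
    simp [perturbed_eq_add_sum_subtype, Matrix.trace_sum]
  -- The trace equals tr A + W with W centred Gaussian, so W ≥ n - tr A and W ≤ -(n + tr A) both
  -- imply instability.
  have hmem : ∀ ω, (n : ℝ) ≤ |(perturbed A S (fun i => z i ω) D).trace| →
      1 ≤ rho (perturbed A S (fun i => z i ω) D) := by
    intro ω h
    have := h.trans (abs_trace_le_mul_rho hn _)
    nlinarith
  refine Q_add_Q_le (by exact_mod_cast hv) hW (by linarith) (fun ω hω => hmem ω ?_)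
    (fun ω hω => hmem ω ?_)
  · rw [htr]
    exact le_trans (by linarith) (le_abs_self _)
  · rw [htr]
    exact le_trans (by linarith) (neg_le_abs _)

end Perturbation

end DataDriven

theorem mainTheorem1 {n m T N p : ℕ} (hn : 0 < n)
    (A : Matrix (Fin n) (Fin n) ℝ) (B : Matrix (Fin n) (Fin m) ℝ)
    (F : Matrix (Fin (m * T)) (Fin N) ℝ → Matrix (Fin p) (Fin N) ℝ → Matrix (Fin m) (Fin n) ℝ)
    (U : Matrix (Fin (m * T)) (Fin N) ℝ) (X : Matrix (Fin p) (Fin N) ℝ)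
    (Acl : Matrix (Fin n) (Fin n) ℝ) (hAcl : Acl = A + B * F U X)
    (hstable : DataDriven.rho Acl < 1)
    (hdiag : DataDriven.IsDiagonalizable Acl)
    (hF : DifferentiableAt ℝ (DataDriven.vecMap F U) X.vec)
    {Ω : Type*} [MeasurableSpace Ω] (P : MeasureTheory.Measure Ω)
    [MeasureTheory.IsProbabilityMeasure P]
    (Z : Ω → Matrix (Fin p) (Fin N) ℝ)
    (S : Finset (Fin N × Fin p)) (hS : S = DataDriven.supp P Z)
    (σ : Fin N × Fin p → NNReal)
    (hgauss : ∀ i ∈ S,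
      ProbabilityTheory.HasLaw (fun ω => (Z ω).vec i)
        (ProbabilityTheory.gaussianReal 0 (σ i ^ 2)) P)
    (hindep : ProbabilityTheory.iIndepFun (fun (i : {i // i ∈ S}) ω => (Z ω).vec i) P)
    (BJ : Fin N × Fin p → Matrix (Fin n) (Fin n) ℝ)
    (hBJ : ∀ i, BJ i = B * DataDriven.J F U X i)
    (μ vlo vup : ℝ) (hμ : μ = Acl.trace)
    (hvlo : vlo = DataDriven.vLower S σ BJ)
    (hvup : vup = DataDriven.vUpper S σ BJ)
    (prob : ℝ)
    (hprob : prob = P.real {ω | 1 ≤ DataDriven.rho (DataDriven.perturbed Acl S (Z ω).vec BJ)}) :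
    (0 < vlo →
      DataDriven.Q ((n + μ) / √vlo) + DataDriven.Q ((n - μ) / √vlo) ≤ prob) ∧
    (0 < vup → ∀ V : Matrix (Fin n) (Fin n) ℂ, DataDriven.IsEigenvectorMatrix Acl V →
      prob ≤ 2 * n * Real.exp
        (-(1 - DataDriven.rho Acl) ^ 2 / (2 * vup * DataDriven.condNumber V ^ 2))) ∧
    (vup = 0 → prob = 0) := by
  subst hμ hvlo hvup hprob
  -- The case `vup = 0` supplies no eigenvector matrix, so diagonalizability provides one.
  obtain ⟨V₀, hV₀⟩ := hdiag
  refine ⟨fun hv => ?_, fun hv V hV => ?_, fun hv => ?_⟩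
  · exact DataDriven.Q_add_Q_le_measureReal_one_le_rho_perturbed hn hgauss hindep hv
  · exact DataDriven.measureReal_one_le_rho_perturbed_le hn hstable hgauss hindep hv hV
  · exact DataDriven.measureReal_one_le_rho_perturbed_eq_zero hn hstable hgauss hindep hv hV₀
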